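/- For $\kappa\ge 0$ let $\mathbb{C}_\kappa=\{s\in\mathbb{C}:\operatorname{Re}s>\kappa\}$. A function $f:\mathbb{C}_\kappa\to\mathbb{C}$ is called almost periodic if it is bounded and uniformly continuous on $\mathbb{C}_\kappa$ and if, for every $\varepsilon>0$, the set of all $\tau\in\mathbb{R}$ with $|f(s+i\tau)-f(s)|\le\varepsilon$ for all $s\in\mathbb{C}_\kappa$ is relatively dense in $\mathbb{R}$, i.e. there is $d>0$ such that every closed interval of length $d$ contains such a $\tau$. Let $H^\infty(\mathbb{C}_0)$ be the space of bounded analytic functions on $\mathbb{C}_0$ with the supremum norm, let $H^\infty_{\mathrm{ap}}(\mathbb{C}_0)$ be the set of all $f\in H^\infty(\mathbb{C}_0)$ whose restriction to $\mathbb{C}_\kappa$ is almost periodic for some $\kappa>0$, and let $A_{\mathrm{ap}}(\mathbb{C}_0)$ be the set of all $f\in H^\infty_{\mathrm{ap}}(\mathbb{C}_0)$ that are uniformly continuous on $\mathbb{C}_0$. Let $\mathscr{P}_D$ be the set of all general Dirichlet polynomials, i.e. functions on $\mathbb{C}_0$ of the form $$f(s)=\sum_{n=1}^N a_n e^{-\lambda_n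 s},\qquad N\ge 1,\quad a_1,\dots,a_N\in\mathbb{C},\quad 0=\lambda_1<\lambda_2<\dots<\lambda_N .$$ **Theorem.** $A_{\mathrm{ap}}(\mathbb{C}_0)=\overline{\mathscr{P}_D}$, where the closure is taken in the supremum norm on $\mathbb{C}_0$. -/

import Mathlib

open scoped BoundedContinuousFunction

/-- The open half-plane of all complex `s` with `κ < Re s`. -/
def halfPlane (κ : ℝ) : Set ℂ := {s : ℂ | κ < s.re}

theorem halfPlane_subset {κ κ' : ℝ} (h : κ ≤ κ') : halfPlane κ' ⊆ halfPlane κ :=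
  fun _ hs => lt_of_le_of_lt h hs

/-- The vertical translation `s ↦ s + iτ` of a half-plane. -/
def verticalShift {κ : ℝ} (τ : ℝ) (s : halfPlane κ) : halfPlane κ :=
  ⟨(s : ℂ) + Complex.I * (τ : ℂ), by
    have h : κ < (s : ℂ).re := s.2
    simpa [halfPlane] using h⟩

/-- A set of reals is relatively dense if, for some `d > 0`, it meets every closed interval of
length `d`. -/
def RelativelyDense (A : Set ℝ) : Prop :=
  ∃ d : ℝ, 0 < d ∧ ∀ x : ℝ, (A ∩ Set.Icc x (x + d)).Nonempty

/-- The set of `ε`-translation numbers of a function on a half-plane. -/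
def translationNumbers {κ : ℝ} (f : halfPlane κ → ℂ) (ε : ℝ) : Set ℝ :=
  {τ : ℝ | ∀ s : halfPlane κ, ‖f (verticalShift τ s) - f s‖ ≤ ε}

/-- Almost periodic functions on a half-plane: bounded, uniformly continuous, and with a relatively
dense set of `ε`-translation numbers for every `ε > 0`. -/
def IsAlmostPeriodic {κ : ℝ} (f : halfPlane κ → ℂ) : Prop :=
  (∃ C : ℝ, ∀ s, ‖f s‖ ≤ C) ∧ UniformContinuous f ∧
    ∀ ε : ℝ, 0 < ε → RelativelyDense (translationNumbers f ε)

/-- The space of bounded analytic functions on the right half-plane. It is a subspace of the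
bounded continuous functions on the half-plane, whose norm is the supremum norm. -/
def HInfty : Submodule ℂ (halfPlane 0 →ᵇ ℂ) where
  carrier := {f | ∃ F : ℂ → ℂ, DifferentiableOn ℂ F (halfPlane 0) ∧ ∀ s : halfPlane 0, f s = F s}
  add_mem' := by
    rintro f g ⟨F, hF, hf⟩ ⟨G, hG, hg⟩
    exact ⟨F + G, hF.add hG, fun s => by simp [hf, hg]⟩
  zero_mem' := ⟨0, differentiableOn_const 0, fun s => by simp⟩
  smul_mem' := by
    rintro c f ⟨F, hF, hf⟩
    exact ⟨c • F, hF.const_smul c, fun s => by simp [hf]⟩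

/-- The bounded analytic functions on the right half-plane whose restriction to some smaller
half-plane is almost periodic. -/
def HInftyAP : Set (halfPlane 0 →ᵇ ℂ) :=
  {f | f ∈ HInfty ∧ ∃ (κ : ℝ) (hκ : 0 < κ),
    IsAlmostPeriodic (fun s : halfPlane κ => f (Set.inclusion (halfPlane_subset hκ.le) s))}

/-- The functions in `HInftyAP` that are uniformly continuous on the whole right half-plane. -/
def AlgebraAP : Set (halfPlane 0 →ᵇ ℂ) :=
  {f | f ∈ HInftyAP ∧ UniformContinuous f}

/-- The function `s ↦ ∑ aₙ exp (-lₙ s)` on the right half-plane. -/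
noncomputable def dirichletSum {N : ℕ} (a : Fin (N + 1) → ℂ) (l : Fin (N + 1) → ℝ)
    (s : halfPlane 0) : ℂ :=
  ∑ n, a n * Complex.exp (-(l n : ℂ) * (s : ℂ))

/-- The general Dirichlet polynomials: the functions `∑ aₙ exp (-lₙ s)` with finitely many (at least
one) frequencies `0 = l₀ < l₁ < ⋯ < l_N` and arbitrary complex coefficients. -/
def generalDirichletPolynomials : Set (halfPlane 0 →ᵇ ℂ) :=
  {f | ∃ (N : ℕ) (a : Fin (N + 1) → ℂ) (l : Fin (N + 1) → ℝ),
    l 0 = 0 ∧ StrictMono l ∧ ∀ s, f s = dirichletSum a l s}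

/-- Every such sum is bounded and continuous, so the set above contains all of them. -/
theorem exists_generalDirichletPolynomial {N : ℕ} (a : Fin (N + 1) → ℂ) (l : Fin (N + 1) → ℝ)
    (h0 : l 0 = 0) (hl : StrictMono l) :
    ∃ f ∈ generalDirichletPolynomials, ∀ s, f s = dirichletSum a l s := by
  have hc : Continuous (dirichletSum a l) := by
    unfold dirichletSum
    fun_prop
  have hb : ∀ s, ‖dirichletSum a l s‖ ≤ ∑ n, ‖a n‖ := by
    intro s
    refine (norm_sum_le _ _).trans (Finset.sum_le_sum fun n _ => ?_)
    have hn : 0 ≤ l n := h0 ▸ hl.monotone (Fin.zero_le n)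
    have hs : 0 < (s : ℂ).re := s.2
    rw [norm_mul, Complex.norm_exp]
    refine mul_le_of_le_one_right (norm_nonneg _) (Real.exp_le_one_iff.2 ?_)
    have := mul_nonneg hn hs.le
    simpa using this
  exact ⟨BoundedContinuousFunction.ofNormedAddCommGroup _ hc _ hb,
    ⟨N, a, l, h0, hl, fun _ => rfl⟩, fun _ => rfl⟩

/-! Vertical translations act on the Banach space of bounded analytic functions as a one-parameter
group of isometries. If `f` is uniformly continuous, its orbit is norm continuous. The three lines
theorem carries almost periodicity from a smaller half-plane to the whole one, so the orbit is
almost periodic in norm (`relativelyDense_of_mem_AlgebraAP`).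

Completing ℝ in the seminorm `τ ↦ ‖U τ f - f‖` gives a compact abelian group `G`, and the orbit
extends to a continuous `Φ` on `G`. Each `∫ χ Φ`, with `χ` a character, is a joint eigenvector of
the translations. Characters span a dense subspace of `C(G, ℂ)`, so Hahn–Banach puts `f` in the
closed span of the eigenvectors (`mem_closure_span_eigenvectors`). An analytic eigenvector is `C exp
(-m s)`, and boundedness forces `m` to be real and nonnegative.

That characters separate points comes from Gelfand theory for the algebra generated by translations
and a convolution operator on `L²(G)`. Conversely, Dirichlet polynomials are uniformly continuous
and almost periodic, and both properties survive uniform limits. -/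

open MeasureTheory

/-! ### Characters of a compact abelian group separate points -/

/-- If all elements of a set in a C⋆-algebra commute with each other and with each other's adjoints,
then the multiplicative star-linear functionals on the algebra it generates separate points. -/
theorem exists_starAlgHom_ne_zero {A : Type*} [CStarAlgebra A] {S : Set A}
    (hcomm : ∀ x ∈ S, ∀ y ∈ S, x * y = y * x)
    (hstar : ∀ x ∈ S, ∀ y ∈ S, x * star y = star y * x)
    {x : A} (hx : x ∈ StarAlgebra.adjoin ℂ S) (hx0 : x ≠ 0) :
    ∃ φ : StarAlgebra.adjoin ℂ S →⋆ₐ[ℂ] ℂ, (∀ y, ‖φ y‖ ≤ ‖y‖) ∧ φ ⟨x, hx⟩ ≠ 0 := by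
  have hc := StarAlgebra.isMulCommutative_adjoin ℂ hcomm hstar
  -- The closure is a commutative C⋆-algebra, so its Gelfand transform is isometric and hence
  -- injective.
  let B := (StarAlgebra.adjoin ℂ S).topologicalClosure
  have hmul : ∀ x y : B, x * y = y * x :=
    (StarSubalgebra.commRingTopologicalClosure (StarAlgebra.adjoin ℂ S)
      fun x y => Subtype.ext (setLike_mul_comm x.2 y.2)).mul_comm
  have : IsClosed (B : Set A) := StarSubalgebra.isClosed_topologicalClosure _
  let _ : CommCStarAlgebra B :=
    { (StarSubalgebra.cstarAlgebra B : CStarAlgebra B) with mul_comm := hmul }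
  let ι : StarAlgebra.adjoin ℂ S →⋆ₐ[ℂ] B :=
    StarSubalgebra.inclusion (StarSubalgebra.le_topologicalClosure _)
  have hne : WeakDual.gelfandTransform ℂ B (ι ⟨x, hx⟩) ≠ 0 :=
    fun h => hx0 (congrArg Subtype.val
      ((gelfandTransform_isometry B).injective (h.trans (map_zero _).symm)))
  obtain ⟨φ, hφ⟩ : ∃ φ, WeakDual.gelfandTransform ℂ B (ι ⟨x, hx⟩) φ ≠ 0 := by
    by_contra! h
    exact hne (ContinuousMap.ext h)
  have : Nontrivial B := ⟨⟨ι ⟨x, hx⟩, 0, fun h => hx0 (congrArg Subtype.val h)⟩⟩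
  refine ⟨(StarAlgHomClass.toStarAlgHom φ).comp ι, fun y => ?_, hφ⟩
  exact AlgHom.norm_apply_le_self (𝕜 := ℂ) φ (ι y)

/-- A functional `φ` not killing `u a * T - T = (u a - 1) * T` has `φ (u a) ≠ 1` and `φ T ≠ 0`. As
`u` itself need not be norm continuous, continuity of `x ↦ φ (u x)` is read off from `φ (u x * T) /
φ T`. -/
theorem exists_continuous_character {A : Type*} [CStarAlgebra A] {G : Type*} [AddCommGroup G]
    [TopologicalSpace G] {u : G → A} (h0 : u 0 = 1) (hadd : ∀ x y, u (x + y) = u x * u y)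
    (hstar : ∀ x, star (u x) = u (-x)) {T : A} (hT : T * star T = star T * T)
    (hu : ∀ x, u x * T = T * u x) (hc : Continuous fun x => u x * T) {a : G} (ha : u a * T ≠ T) :
    ∃ χ : C(G, ℂ), (∀ x y, χ (x + y) = χ x * χ y) ∧ (∀ x, ‖χ x‖ = 1) ∧ χ a ≠ 1 := by
  have hu' : ∀ x, u x * star T = star T * u x := fun x => by
    have := congrArg star (hu (-x))
    simpa [hstar] using this.symm
  let S : Set A := insert T (Set.range u)
  have huS : ∀ x, u x ∈ StarAlgebra.adjoin ℂ S := fun x =>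
    StarAlgebra.subset_adjoin ℂ S (Or.inr ⟨x, rfl⟩)
  have hTS : T ∈ StarAlgebra.adjoin ℂ S := StarAlgebra.subset_adjoin ℂ S (Or.inl rfl)
  obtain ⟨φ, hφ, hφ0⟩ := exists_starAlgHom_ne_zero (S := S) (x := u a * T - T)
    (by
      rintro x (rfl | ⟨b, rfl⟩) y (rfl | ⟨c, rfl⟩)
      · rfl
      · exact (hu c).symm
      · exact hu b
      · rw [← hadd, ← hadd, add_comm])
    (by
      rintro x (rfl | ⟨b, rfl⟩) y (rfl | ⟨c, rfl⟩)
      · exact hT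
      · rw [hstar, hu]
      · exact hu' b
      · rw [hstar, ← hadd, ← hadd, add_comm])
    (sub_mem (mul_mem (huS a) hTS) hTS) (sub_ne_zero.2 ha)
  have key : ∀ x, φ ⟨u x * T, mul_mem (huS x) hTS⟩ = φ ⟨u x, huS x⟩ * φ ⟨T, hTS⟩ := fun x => by
    rw [← map_mul]; rfl
  have hsub : φ ⟨u a * T - T, sub_mem (mul_mem (huS a) hTS) hTS⟩ =
      (φ ⟨u a, huS a⟩ - 1) * φ ⟨T, hTS⟩ := by
    rw [sub_mul, ← key, one_mul, ← map_sub]; rfl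
  rw [hsub, mul_ne_zero_iff, sub_ne_zero] at hφ0
  have hφc : Continuous φ := by
    refine AddMonoidHomClass.continuous_of_bound φ 1 fun y => ?_
    simpa using hφ y
  have hmul : ∀ x y, φ ⟨u (x + y), huS _⟩ = φ ⟨u x, huS x⟩ * φ ⟨u y, huS y⟩ := fun x y => by
    rw [← map_mul]; congr 1; exact Subtype.ext (hadd x y)
  refine ⟨⟨fun x => φ ⟨u x, huS x⟩, ?_⟩, hmul, fun x => ?_, hφ0.1⟩
  · have : Continuous fun x => φ ⟨u x * T, mul_mem (huS x) hTS⟩ / φ ⟨T, hTS⟩ :=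
      (hφc.comp (hc.subtype_mk _)).div_const _
    refine this.congr fun x => ?_
    rw [key, mul_div_cancel_right₀ _ hφ0.2]
  · have h1 : φ ⟨u x, huS x⟩ * star (φ ⟨u x, huS x⟩) = 1 := by
      rw [← map_star, ← map_mul, ← map_one φ]
      congr 1
      refine Subtype.ext ?_
      change u x * star (u x) = 1
      rw [hstar, ← hadd, add_neg_cancel, h0]
    have h2 := congrArg norm h1
    rw [norm_mul, norm_star, norm_one, ← sq] at h2
    exact (pow_eq_one_iff_of_nonneg (norm_nonneg _) two_ne_zero).1 h2

section Translation

variable {G : Type*} [NormedAddCommGroup G] [MeasurableSpace G] [BorelSpace G]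
  (μ : Measure G) [μ.IsAddHaarMeasure]

/-- Translation as an operator on `L²` of a compact abelian group. -/
noncomputable def lpTranslation (a : G) : Lp ℂ 2 μ →L[ℂ] Lp ℂ 2 μ :=
  (Lp.compMeasurePreservingₗᵢ ℂ (a + ·) (measurePreserving_add_left μ a)).toContinuousLinearMap

theorem lpTranslation_zero : lpTranslation μ 0 = 1 := by
  ext1 f
  have : ((0 : G) + ·) = id := funext zero_add
  simp only [lpTranslation]
  change Lp.compMeasurePreserving _ _ _ = _
  simp only [this]
  exact Lp.compMeasurePreserving_id_apply f

theorem lpTranslation_add (a b : G) :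
    lpTranslation μ (a + b) = lpTranslation μ a * lpTranslation μ b := by
  ext1 f
  have : ((a + b) + ·) = (b + ·) ∘ (a + ·) := funext fun x => by
    simp only [Function.comp]; abel
  change Lp.compMeasurePreserving _ _ _ =
    Lp.compMeasurePreserving _ _ (Lp.compMeasurePreserving _ _ f)
  simp only [this]
  exact Lp.compMeasurePreserving_comp_apply f _ _

theorem norm_lpTranslation_apply (a : G) (f : Lp ℂ 2 μ) : ‖lpTranslation μ a f‖ = ‖f‖ :=
  LinearIsometry.norm_map _ f

theorem commute_lpTranslation (a b : G) : Commute (lpTranslation μ a) (lpTranslation μ b) := by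
  rw [Commute, SemiconjBy, ← lpTranslation_add, ← lpTranslation_add, add_comm]

theorem star_lpTranslation (a : G) : star (lpTranslation μ a) = lpTranslation μ (-a) := by
  have h1 : star (lpTranslation μ a) * lpTranslation μ a = 1 :=
    (ContinuousLinearMap.norm_map_iff_adjoint_comp_self _).1 (norm_lpTranslation_apply μ a)
  calc star (lpTranslation μ a)
      = star (lpTranslation μ a) * (lpTranslation μ a * lpTranslation μ (-a)) := by
        rw [← lpTranslation_add, add_neg_cancel, lpTranslation_zero, mul_one]
    _ = lpTranslation μ (-a) := by rw [← mul_assoc, h1, one_mul]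

variable [CompactSpace G]

theorem continuous_lpTranslation_apply (f : Lp ℂ 2 μ) : Continuous fun a => lpTranslation μ a f := by
  have hg : Continuous fun a : G => (⟨(a + ·), by fun_prop⟩ : C(G, G)) :=
    ContinuousMap.continuous_of_continuous_uncurry _ (by
      change Continuous fun p : G × G => p.1 + p.2
      fun_prop)
  exact (continuous_const (y := f)).compMeasurePreservingLp hg
    (fun a => measurePreserving_add_left μ a) (by simp)

theorem integrable_smul_lpTranslation (k : C(G, ℂ)) (f : Lp ℂ 2 μ) :
    Integrable (fun y => k y • lpTranslation μ y f) μ :=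
  (k.continuous.smul (continuous_lpTranslation_apply μ f)).integrable_of_hasCompactSupport
    (HasCompactSupport.of_compactSpace _)

/-- The convolution operator `∫ k(y) u_y dμ(y)` on `L²`, where `u_y` are the translations. -/
noncomputable def lpConvolution (k : C(G, ℂ)) : Lp ℂ 2 μ →L[ℂ] Lp ℂ 2 μ :=
  LinearMap.mkContinuous
    { toFun := fun f => ∫ y, k y • lpTranslation μ y f ∂μ
      map_add' := fun f g => by
        simp only [map_add, smul_add]
        exact integral_add (integrable_smul_lpTranslation μ k f)
          (integrable_smul_lpTranslation μ k g)
      map_smul' := fun c f => by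
        simp only [map_smul, smul_comm _ c, RingHom.id_apply]
        exact integral_smul c _ }
    (‖k‖ * μ.real Set.univ) (fun f => by
      refine (norm_integral_le_of_norm_le_const (C := ‖k‖ * ‖f‖) (ae_of_all _ fun y => ?_)).trans
        (le_of_eq (by ring))
      rw [norm_smul, norm_lpTranslation_apply]
      gcongr
      exact k.norm_coe_le_norm y)

theorem lpConvolution_apply (k : C(G, ℂ)) (f : Lp ℂ 2 μ) :
    lpConvolution μ k f = ∫ y, k y • lpTranslation μ y f ∂μ := rfl

theorem norm_lpConvolution_le (k : C(G, ℂ)) : ‖lpConvolution μ k‖ ≤ ‖k‖ * μ.real Set.univ :=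
  LinearMap.mkContinuous_norm_le _ (by positivity) _

theorem lpConvolution_sub (k l : C(G, ℂ)) :
    lpConvolution μ (k - l) = lpConvolution μ k - lpConvolution μ l := by
  ext1 f
  simp only [lpConvolution_apply, sub_apply, ContinuousMap.sub_apply, sub_smul]
  exact integral_sub (integrable_smul_lpTranslation μ k f) (integrable_smul_lpTranslation μ l f)

/-- An operator commuting with all translations commutes with convolutions. -/
theorem commute_lpConvolution {R : Lp ℂ 2 μ →L[ℂ] Lp ℂ 2 μ}
    (hR : ∀ a, Commute R (lpTranslation μ a)) (k : C(G, ℂ)) : Commute R (lpConvolution μ k) := by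
  ext1 f
  simp only [mul_apply_eq_comp, lpConvolution_apply]
  rw [← ContinuousLinearMap.integral_comp_comm _ (integrable_smul_lpTranslation μ k f)]
  refine integral_congr_ae (ae_of_all _ fun y => ?_)
  simp only [map_smul]
  congr 1
  exact DFunLike.congr_fun (hR y).eq f

/-- Moving the translation onto the kernel gives norm continuity in `a`, since kernels depend
continuously on their translation in sup norm. -/
theorem lpTranslation_mul_lpConvolution (a : G) (k : C(G, ℂ)) :
    lpTranslation μ a * lpConvolution μ k =
      lpConvolution μ (k.comp ⟨(-a + ·), by fun_prop⟩) := by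
  ext1 f
  simp only [mul_apply_eq_comp, lpConvolution_apply]
  rw [← ContinuousLinearMap.integral_comp_comm _ (integrable_smul_lpTranslation μ k f)]
  rw [← integral_add_left_eq_self (fun y => k.comp ⟨(-a + ·), _⟩ y • lpTranslation μ y f) a]
  refine integral_congr_ae (ae_of_all _ fun y => ?_)
  simp [lpTranslation_add]

theorem eq_zero_of_integral_star_mul_self {k : C(G, ℂ)} (h : ∫ y, star (k y) * k y ∂μ = 0) :
    k = 0 := by
  have h3 : ∫ y, ‖k y‖ ^ 2 ∂μ = 0 := by
    have h4 : ∀ y, star (k y) * k y = ((‖k y‖ ^ 2 : ℝ) : ℂ) := fun y => by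
      simp [Complex.conj_mul']
    simp only [h4] at h
    exact Complex.ofReal_eq_zero.1 (integral_ofReal.symm.trans h)
  have hc : Continuous fun y => ‖k y‖ ^ 2 := by fun_prop
  refine ContinuousMap.ext fun x => ?_
  by_contra hx
  refine (hc.integral_pos_of_hasCompactSupport_nonneg_nonzero (μ := μ) (x := x)
    (HasCompactSupport.of_compactSpace _) (fun y => by positivity) ?_).ne' h3
  simpa using hx

/-- Convolution with a nonzero continuous function is a nonzero operator. -/
theorem lpConvolution_ne_zero {k : C(G, ℂ)} (hk : k ≠ 0) : lpConvolution μ k ≠ 0 := by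
  intro h
  -- Convolving the conjugate of `k` gives `∫ |k|²` at `0`. The integral is taken in `C(G, ℂ)` so
  -- that evaluation at a point makes sense.
  let v : C(G, ℂ) := ⟨fun x => star (k x), by fun_prop⟩
  let w : G → C(G, ℂ) := fun y => v.comp ⟨(y + ·), by fun_prop⟩
  have hw : Continuous w := ContinuousMap.continuous_of_continuous_uncurry _ (by
    change Continuous fun p : G × G => v (p.1 + p.2)
    fun_prop)
  have hint : Integrable (fun y => k y • w y) μ :=
    (k.continuous.smul hw).integrable_of_hasCompactSupport (HasCompactSupport.of_compactSpace _)
  have h1 : ContinuousMap.toLp 2 μ ℂ (∫ y, k y • w y ∂μ) = 0 := by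
    rw [← ContinuousLinearMap.integral_comp_comm _ hint]
    have := DFunLike.congr_fun h (v.toLp 2 μ ℂ)
    rw [lpConvolution_apply] at this
    simp only [map_smul]
    exact this
  have h2 : ∫ y, k y • w y ∂μ = 0 := ContinuousMap.toLp_injective μ (h1.trans (map_zero _).symm)
  refine hk (eq_zero_of_integral_star_mul_self μ ?_)
  have := congrArg (ContinuousMap.evalCLM ℂ (0 : G)) h2
  rw [← ContinuousLinearMap.integral_comp_comm _ hint, map_zero] at this
  rw [← this]
  refine integral_congr_ae (ae_of_all _ fun y => ?_)
  simp [w, v, mul_comm]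

end Translation

/-- The continuous characters of a compact abelian group separate points. -/
theorem exists_character_ne_one {G : Type*} [NormedAddCommGroup G] [CompactSpace G] {a : G}
    (ha : a ≠ 0) :
    ∃ χ : C(G, ℂ), (∀ x y, χ (x + y) = χ x * χ y) ∧ (∀ x, ‖χ x‖ = 1) ∧ χ a ≠ 1 := by
  borelize G
  let μ : Measure G := Measure.addHaar
  -- The norm vanishes only at `0`, so this kernel and its translate by `a` differ there.
  let k : C(G, ℂ) := ⟨fun x => (‖x‖ : ℂ), by fun_prop⟩
  have hcomm : ∀ x, Commute (lpTranslation μ x) (lpConvolution μ k) := fun x =>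
    commute_lpConvolution μ (commute_lpTranslation μ x) k
  have hstar : ∀ x, Commute (star (lpConvolution μ k)) (lpTranslation μ x) := fun x => by
    have := (hcomm (-x)).star_star
    rw [star_lpTranslation, neg_neg] at this
    exact this.symm
  refine exists_continuous_character (u := lpTranslation μ) (T := lpConvolution μ k)
    (lpTranslation_zero μ) (lpTranslation_add μ) (star_lpTranslation μ)
    (commute_lpConvolution μ hstar k).symm.eq (fun x => (hcomm x).eq) ?_ ?_
  · simp only [lpTranslation_mul_lpConvolution]
    let w : G → C(G, ℂ) := fun x => k.comp ⟨(-x + ·), by fun_prop⟩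
    have hw : Continuous w := ContinuousMap.continuous_of_continuous_uncurry _ (by
      change Continuous fun p : G × G => k (-p.1 + p.2)
      fun_prop)
    have hT : LipschitzWith (μ.real Set.univ).toNNReal (lpConvolution μ) := by
      refine LipschitzWith.of_dist_le_mul fun k l => ?_
      rw [dist_eq_norm, dist_eq_norm, ← lpConvolution_sub, Real.coe_toNNReal _ (by positivity),
        mul_comm]
      exact norm_lpConvolution_le μ _
    exact hT.continuous.comp hw
  · rw [lpTranslation_mul_lpConvolution, ← sub_ne_zero, ← lpConvolution_sub]
    refine lpConvolution_ne_zero μ fun h => ha ?_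
    simpa [k] using DFunLike.congr_fun h 0

/-! ### Density of the span of characters -/

/-- The unitary characters of a topological abelian group, as a submonoid of the continuous
functions. -/
def unitaryCharacters (G : Type*) [AddCommGroup G] [TopologicalSpace G] : Submonoid C(G, ℂ) where
  carrier := {χ | (∀ x y, χ (x + y) = χ x * χ y) ∧ ∀ x, ‖χ x‖ = 1}
  one_mem' := by simp
  mul_mem' := by
    rintro χ ψ ⟨h1, h2⟩ ⟨h3, h4⟩
    refine ⟨fun x y => ?_, fun x => ?_⟩
    · simp only [ContinuousMap.mul_apply, h1, h3]; ring
    · simp [h2, h4]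

theorem star_mem_unitaryCharacters {G : Type*} [AddCommGroup G] [TopologicalSpace G] {χ : C(G, ℂ)}
    (h : χ ∈ unitaryCharacters G) : star χ ∈ unitaryCharacters G :=
  ⟨fun x y => by simp [h.1], fun x => by simpa using h.2 x⟩

/-- On a compact abelian group, the linear combinations of characters are dense in the continuous
functions. -/
theorem dense_span_unitaryCharacters {G : Type*} [NormedAddCommGroup G] [CompactSpace G] :
    (Submodule.span ℂ (unitaryCharacters G : Set C(G, ℂ))).topologicalClosure = ⊤ := by
  let A : StarSubalgebra ℂ C(G, ℂ) :=
    { Algebra.adjoin ℂ (unitaryCharacters G : Set C(G, ℂ)) with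
      star_mem' := fun {f} hf => by
        change f ∈ Algebra.adjoin ℂ _ at hf
        change star f ∈ Algebra.adjoin ℂ _
        rw [← Subalgebra.mem_star_iff, Subalgebra.star_adjoin_comm]
        refine Algebra.adjoin_mono (fun χ hχ => ?_) hf
        exact star_mem_unitaryCharacters hχ }
  have hA : A.SeparatesPoints := by
    intro x y hxy
    obtain ⟨χ, h1, h2, h3⟩ := exists_character_ne_one (sub_ne_zero.2 hxy)
    refine ⟨χ, ⟨χ, Algebra.subset_adjoin ⟨h1, h2⟩, rfl⟩, fun h => h3 ?_⟩
    have h4 := h1 (x - y) y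
    rw [sub_add_cancel, h] at h4
    have h5 : χ y ≠ 0 := norm_ne_zero_iff.1 (by rw [h2]; exact one_ne_zero)
    exact (mul_eq_right₀ h5).1 h4.symm
  have htop := ContinuousMap.starSubalgebra_topologicalClosure_eq_top_of_separatesPoints A hA
  -- Products of characters are characters, so the algebra given to Stone–Weierstrass is just their
  -- linear span.
  have hspan : Subalgebra.toSubmodule (Algebra.adjoin ℂ (unitaryCharacters G : Set C(G, ℂ))) =
      Submodule.span ℂ (unitaryCharacters G : Set C(G, ℂ)) := by
    rw [Algebra.adjoin_eq_span, Submonoid.closure_eq]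
  rw [← hspan, eq_top_iff]
  intro f _
  have : f ∈ A.topologicalClosure := htop ▸ trivial
  exact this

/-! ### Almost periodic vectors and joint eigenvectors -/

/-- Integration against a fixed continuous function on a compact space, as a functional. -/
theorem exists_integral_mul_functional {X : Type*} [TopologicalSpace X] [CompactSpace X]
    [MeasurableSpace X] [BorelSpace X] (μ : Measure X) [IsFiniteMeasure μ] (g : C(X, ℂ)) :
    ∃ L : C(X, ℂ) →L[ℂ] ℂ, ∀ k, L k = ∫ x, k x * g x ∂μ := by
  have hint : ∀ k : C(X, ℂ), Integrable (fun x => k x * g x) μ := fun k =>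
    (k * g).continuous.integrable_of_hasCompactSupport (HasCompactSupport.of_compactSpace _)
  refine ⟨LinearMap.mkContinuous
    { toFun := fun k => ∫ x, k x * g x ∂μ
      map_add' := fun k l => by
        simp only [ContinuousMap.add_apply, add_mul]
        exact integral_add (hint k) (hint l)
      map_smul' := fun c k => by
        simp only [ContinuousMap.smul_apply, smul_eq_mul, mul_assoc, RingHom.id_apply]
        exact integral_const_mul c _ }
    (‖g‖ * μ.real Set.univ) fun k => ?_, fun k => rfl⟩
  refine (norm_integral_le_of_norm_le_const (C := ‖k‖ * ‖g‖) (ae_of_all _ fun x => ?_)).trans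
    (le_of_eq (by ring))
  rw [norm_mul]
  gcongr
  · exact k.norm_coe_le_norm x
  · exact g.norm_coe_le_norm x

theorem Submodule.exists_functional_ne_zero {E : Type*} [NormedAddCommGroup E] [NormedSpace ℂ E]
    {Y : Submodule ℂ E} (hY : IsClosed (Y : Set E)) {v : E} (hv : v ∉ Y) :
    ∃ l : E →L[ℂ] ℂ, (∀ y ∈ Y, l y = 0) ∧ l v ≠ 0 := by
  have : IsClosed (Y : Set E) := hY
  obtain ⟨l, hl⟩ := SeparatingDual.exists_ne_zero (R := ℂ) (V := E ⧸ Y) (x := Y.mkQL v)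
    (by simpa using hv)
  exact ⟨l.comp Y.mkQL, fun y hy => by simp [(Submodule.Quotient.mk_eq_zero Y).2 hy], hl⟩

/-- If a family of isometries is the translation action along an orbit map of a compact abelian
group, then that orbit lies in the closed span of the joint eigenvectors. -/
theorem orbit_mem_closure_span_eigenvectors {E : Type*} [NormedAddCommGroup E] [NormedSpace ℂ E]
    [CompleteSpace E] {G : Type*} [NormedAddCommGroup G] [CompactSpace G] {T : Type*}
    {U : T → E →ₗᵢ[ℂ] E} {Φ : G → E} (hΦ : Continuous Φ) {ι : T → G}
    (h : ∀ τ x, U τ (Φ x) = Φ (ι τ + x)) (x : G) :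
    Φ x ∈ (Submodule.span ℂ
      {v : E | ∃ c : T → ℂ, ∀ τ, U τ v = c τ • v}).topologicalClosure := by
  borelize G
  let μ : Measure G := Measure.addHaar
  by_contra hx
  obtain ⟨l, hl, hlx⟩ :=
    Submodule.exists_functional_ne_zero (Submodule.isClosed_topologicalClosure _) hx
  have hint : ∀ k : C(G, ℂ), Integrable (fun x => k x • Φ x) μ := fun k =>
    (k.continuous.smul hΦ).integrable_of_hasCompactSupport (HasCompactSupport.of_compactSpace _)
  let g : C(G, ℂ) := ⟨fun x => l (Φ x), l.continuous.comp hΦ⟩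
  obtain ⟨L, hL⟩ := exists_integral_mul_functional μ g
  have hLk : ∀ k, L k = l (∫ x, k x • Φ x ∂μ) := fun k => by
    rw [hL, ← ContinuousLinearMap.integral_comp_comm _ (hint k)]
    simp [g]
  -- Invariance of `μ` makes `∫ χ Φ` an eigenvector with eigenvalue `χ (-ι τ)`, so `l` kills it. By
  -- density `L` vanishes, and testing it on `star g` gives `g = 0`.
  have hchar : (unitaryCharacters G : Set C(G, ℂ)) ⊆ LinearMap.ker L.toLinearMap := by
    intro χ hχ
    change L χ = 0
    rw [hLk]
    refine hl _ (Submodule.le_topologicalClosure _ (Submodule.subset_span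
      ⟨fun τ => χ (-ι τ), fun τ => ?_⟩))
    change (U τ).toContinuousLinearMap (∫ x, χ x • Φ x ∂μ) = _
    rw [← ContinuousLinearMap.integral_comp_comm _ (hint χ), ← integral_smul,
      ← integral_add_left_eq_self (fun x => χ (-ι τ) • χ x • Φ x) (ι τ)]
    refine integral_congr_ae (ae_of_all _ fun x => ?_)
    have : χ (-ι τ) * χ (ι τ + x) = χ x := by rw [← hχ.1, neg_add_cancel_left]
    simp [h, smul_smul, this]
  have hker : (⊤ : Submodule ℂ C(G, ℂ)) ≤ LinearMap.ker L.toLinearMap := by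
    rw [← dense_span_unitaryCharacters]
    exact Submodule.topologicalClosure_minimal _ (Submodule.span_le.2 hchar) L.isClosed_ker
  have hg : g = 0 := eq_zero_of_integral_star_mul_self μ <| by
    have : L (star g) = 0 := hker (Submodule.mem_top (x := star g))
    rwa [hL] at this
  exact hlx (DFunLike.congr_fun hg x)

/-- The real line with the topology of an invariant seminorm. -/
def SeminormedLine (_p : AddGroupSeminorm ℝ) : Type := ℝ

noncomputable instance (p : AddGroupSeminorm ℝ) : SeminormedAddCommGroup (SeminormedLine p) :=
  p.toSeminormedAddCommGroup (E := ℝ)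

/-- The identity map onto the seminormed line. -/
def SeminormedLine.of (p : AddGroupSeminorm ℝ) : ℝ ≃+ SeminormedLine p := AddEquiv.refl ℝ

theorem SeminormedLine.dist_of (p : AddGroupSeminorm ℝ) (a b : ℝ) :
    dist (of p a) (of p b) = p (-a + b) := rfl

/-- Almost-periods bring every point within `ε / 2` of `[0, d]`, whose image is compact because `p`
is continuous. -/
theorem totallyBounded_seminormedLine {p : AddGroupSeminorm ℝ} (hc : Continuous p)
    (hp : ∀ ε : ℝ, 0 < ε → RelativelyDense {τ | p τ ≤ ε}) :
    TotallyBounded (Set.univ : Set (SeminormedLine p)) := by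
  let j := SeminormedLine.of p
  have hj : Continuous j := by
    refine continuous_iff_continuousAt.2 fun a => ?_
    rw [ContinuousAt, tendsto_iff_dist_tendsto_zero]
    have : Continuous fun x : ℝ => p (-x + a) := by fun_prop
    simpa [j, SeminormedLine.dist_of] using this.tendsto a
  rw [Metric.totallyBounded_iff]
  intro ε hε
  obtain ⟨d, hd, hd'⟩ := hp (ε / 2) (half_pos hε)
  have hK : TotallyBounded (j '' Set.Icc 0 d) := (isCompact_Icc.image hj).totallyBounded
  obtain ⟨t, ht, hcov⟩ := Metric.totallyBounded_iff.1 hK (ε / 2) (half_pos hε)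
  refine ⟨t, ht, fun x _ => ?_⟩
  obtain ⟨x, rfl⟩ := j.surjective x
  obtain ⟨τ, hτ, hτ1, hτ2⟩ := hd' (x - d)
  have hx : j (x - τ) ∈ j '' Set.Icc 0 d := ⟨_, ⟨by linarith, by linarith⟩, rfl⟩
  obtain ⟨y, hy, hxy⟩ := Set.mem_iUnion₂.1 (hcov hx)
  refine Set.mem_iUnion₂.2 ⟨y, hy, ?_⟩
  rw [Metric.mem_ball] at hxy ⊢
  have h1 : dist (j x) (j (x - τ)) ≤ ε / 2 := by
    rw [SeminormedLine.dist_of, show -x + (x - τ) = -τ by ring, map_neg_eq_map]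
    exact hτ
  linarith [dist_triangle (j x) (j (x - τ)) y]

theorem compactSpace_completion {X : Type*} [UniformSpace X]
    (h : TotallyBounded (Set.univ : Set X)) : CompactSpace (UniformSpace.Completion X) := by
  refine ⟨?_⟩
  have := (h.image (UniformSpace.Completion.uniformContinuous_coe X)).closure
  rw [Set.image_univ, UniformSpace.Completion.denseRange_coe.closure_range] at this
  exact this.isCompact_of_isClosed isClosed_univ

/-- A vector with almost periodic orbit under a one-parameter group of isometries lies in the closed
span of the joint eigenvectors. -/
theorem mem_closure_span_eigenvectors {E : Type*} [NormedAddCommGroup E] [NormedSpace ℂ E]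
    [CompleteSpace E] {U : ℝ → E →ₗᵢ[ℂ] E} (h0 : ∀ v, U 0 v = v)
    (hadd : ∀ a b v, U (a + b) v = U a (U b v)) {v : E} (hc : Continuous fun τ => U τ v)
    (hap : ∀ ε : ℝ, 0 < ε → RelativelyDense {τ | ‖U τ v - v‖ ≤ ε}) :
    v ∈ (Submodule.span ℂ {w : E | ∃ c : ℝ → ℂ, ∀ τ, U τ w = c τ • w}).topologicalClosure := by
  -- For this seminorm the orbit map is an isometry, so it extends to the completion.
  let p : AddGroupSeminorm ℝ :=
    { toFun := fun τ => ‖U τ v - v‖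
      map_zero' := by simp [h0]
      add_le' := fun a b => by
        have : U (a + b) v - v = U a (U b v - v) + (U a v - v) := by rw [map_sub, hadd]; abel
        rw [this]
        refine (norm_add_le _ _).trans ?_
        rw [LinearIsometry.norm_map, add_comm]
      neg' := fun a => by
        rw [← (U a).norm_map, map_sub, ← hadd, add_neg_cancel, h0, norm_sub_rev] }
  have hpc : Continuous p := (hc.sub continuous_const).norm
  have := compactSpace_completion (totallyBounded_seminormedLine hpc hap)
  let j := SeminormedLine.of p
  let orb : SeminormedLine p → E := fun x => U (j.symm x) v
  have horb : Isometry orb := by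
    refine Isometry.of_dist_eq fun x y => ?_
    obtain ⟨a, rfl⟩ := j.surjective x
    obtain ⟨b, rfl⟩ := j.surjective y
    rw [SeminormedLine.dist_of, dist_comm, dist_eq_norm]
    simp only [orb, AddEquiv.symm_apply_apply]
    change _ = ‖U (-a + b) v - v‖
    rw [← (U (-a)).norm_map, map_sub, ← hadd, ← hadd, neg_add_cancel, h0]
  let Φ : UniformSpace.Completion (SeminormedLine p) → E := UniformSpace.Completion.extension orb
  have hΦ : Continuous Φ := UniformSpace.Completion.continuous_extension
  have hcoe : ∀ x : SeminormedLine p, Φ x = orb x :=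
    UniformSpace.Completion.extension_coe horb.uniformContinuous
  have hU : ∀ τ x, U τ (Φ x) = Φ ((j τ : UniformSpace.Completion (SeminormedLine p)) + x) := by
    intro τ x
    refine UniformSpace.Completion.induction_on x (isClosed_eq (by fun_prop) (by fun_prop))
      fun s => ?_
    rw [← UniformSpace.Completion.coe_add, hcoe, hcoe]
    simp only [orb, map_add, AddEquiv.symm_apply_apply]
    exact (hadd _ _ _).symm
  have := orbit_mem_closure_span_eigenvectors hΦ hU (j 0 : UniformSpace.Completion _)
  rwa [hcoe, show orb (j 0) = v from h0 v] at this

/-! ### Vertical translations of bounded analytic functions and their eigenvectors -/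

theorem isOpen_halfPlane (κ : ℝ) : IsOpen (halfPlane κ) :=
  isOpen_lt continuous_const Complex.continuous_re

theorem convex_halfPlane (κ : ℝ) : Convex ℝ (halfPlane κ) :=
  convex_halfSpace_re_gt κ

theorem add_mem_halfPlane {κ τ : ℝ} {s : ℂ} (hs : s ∈ halfPlane κ) :
    s + Complex.I * τ ∈ halfPlane κ :=
  (verticalShift τ ⟨s, hs⟩).2

theorem continuous_verticalShift {κ : ℝ} (τ : ℝ) :
    Continuous (verticalShift τ : halfPlane κ → halfPlane κ) := by
  unfold verticalShift
  fun_prop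

theorem verticalShift_zero {κ : ℝ} (s : halfPlane κ) : verticalShift 0 s = s :=
  Subtype.ext (by simp [verticalShift])

theorem verticalShift_add {κ : ℝ} (a b : ℝ) (s : halfPlane κ) :
    verticalShift (a + b) s = verticalShift b (verticalShift a s) :=
  Subtype.ext (by simp [verticalShift]; ring)

theorem isClosed_HInfty : IsClosed (HInfty : Set (halfPlane 0 →ᵇ ℂ)) := by
  refine isClosed_of_closure_subset fun f hf => ?_
  obtain ⟨u, hu, hlim⟩ := mem_closure_iff_seq_limit.1 hf
  choose F hF hFu using hu
  let Ff : ℂ → ℂ := Function.extend Subtype.val f 0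
  have hext : ∀ s : halfPlane 0, Ff s = f s := fun s =>
    Subtype.val_injective.extend_apply f 0 s
  refine ⟨Ff, ?_, fun s => (hext s).symm⟩
  have h1 := BoundedContinuousFunction.tendsto_iff_tendstoUniformly.1 hlim
  have h2 : TendstoUniformlyOn F Ff Filter.atTop (halfPlane 0) := by
    rw [Metric.tendstoUniformlyOn_iff]
    intro ε hε
    filter_upwards [Metric.tendstoUniformly_iff.1 h1 ε hε] with n hn s hs
    simpa [hext ⟨s, hs⟩, hFu n ⟨s, hs⟩] using hn ⟨s, hs⟩
  exact h2.tendstoLocallyUniformlyOn.differentiableOn (Filter.Eventually.of_forall hF)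
    (isOpen_halfPlane 0)

noncomputable instance : CompleteSpace HInfty := isClosed_HInfty.completeSpace_coe

/-- The function `s ↦ f (s + iτ)`. -/
noncomputable def boundedShift (τ : ℝ) (f : halfPlane 0 →ᵇ ℂ) : halfPlane 0 →ᵇ ℂ :=
  f.compContinuous ⟨verticalShift τ, continuous_verticalShift τ⟩

theorem boundedShift_apply (τ : ℝ) (f : halfPlane 0 →ᵇ ℂ) (s : halfPlane 0) :
    boundedShift τ f s = f (verticalShift τ s) := rfl

theorem boundedShift_zero (f : halfPlane 0 →ᵇ ℂ) : boundedShift 0 f = f := by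
  ext s; rw [boundedShift_apply, verticalShift_zero]

theorem boundedShift_add (a b : ℝ) (f : halfPlane 0 →ᵇ ℂ) :
    boundedShift (a + b) f = boundedShift a (boundedShift b f) := by
  ext s; simp only [boundedShift_apply, verticalShift_add]

theorem norm_boundedShift (τ : ℝ) (f : halfPlane 0 →ᵇ ℂ) : ‖boundedShift τ f‖ = ‖f‖ := by
  have h : ∀ (τ : ℝ) (g : halfPlane 0 →ᵇ ℂ), ‖boundedShift τ g‖ ≤ ‖g‖ := fun τ g =>
    (BoundedContinuousFunction.norm_le (norm_nonneg _)).2 fun s => g.norm_coe_le_norm _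
  refine (h τ f).antisymm ?_
  simpa [← boundedShift_add, boundedShift_zero] using h (-τ) (boundedShift τ f)

theorem boundedShift_mem_HInfty (τ : ℝ) {f : halfPlane 0 →ᵇ ℂ} (hf : f ∈ HInfty) :
    boundedShift τ f ∈ HInfty := by
  obtain ⟨F, hF, hfF⟩ := hf
  refine ⟨fun s => F (s + Complex.I * τ), ?_, fun s => hfF _⟩
  exact hF.comp (by fun_prop) fun s hs => add_mem_halfPlane hs

/-- Vertical translation as an isometry of the space of bounded analytic functions. -/
noncomputable def HInftyShift (τ : ℝ) : HInfty →ₗᵢ[ℂ] HInfty where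
  toFun f := ⟨boundedShift τ f, boundedShift_mem_HInfty τ f.2⟩
  map_add' _ _ := rfl
  map_smul' _ _ := rfl
  norm_map' f := norm_boundedShift τ f

/-- An exponential sum with nonnegative, possibly repeated, frequencies is a general Dirichlet
polynomial. -/
theorem mem_generalDirichletPolynomials {ι : Type*} [Fintype ι] {a : ι → ℂ} {l : ι → ℝ}
    (hl : ∀ i, 0 ≤ l i) {f : halfPlane 0 →ᵇ ℂ}
    (hf : ∀ s, f s = ∑ i, a i * Complex.exp (-(l i : ℂ) * (s : ℂ))) :
    f ∈ generalDirichletPolynomials := by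
  classical
  -- Frequency `0` is inserted because it must be listed, possibly with zero coefficient; `c` merges
  -- equal frequencies.
  let S : Finset ℝ := insert 0 (Finset.univ.image l)
  have hpos : 0 < S.card := Finset.card_pos.2 (Finset.insert_nonempty _ _)
  obtain ⟨N, hN⟩ : ∃ N, S.card = N + 1 := ⟨S.card - 1, by omega⟩
  let c : ℝ → ℂ := fun x => ∑ i with l i = x, a i
  have hmem : ∀ x ∈ S, 0 ≤ x := by
    intro x hx
    simp only [S, Finset.mem_insert, Finset.mem_image, Finset.mem_univ, true_and] at hx
    obtain rfl | ⟨i, rfl⟩ := hx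
    exacts [le_rfl, hl i]
  let m : Fin (N + 1) ↪o ℝ := S.orderEmbOfFin hN
  refine ⟨N, fun n => c (m n), m, ?_, m.strictMono, fun s => ?_⟩
  · have h1 : m 0 ∈ S := S.orderEmbOfFin_mem hN 0
    obtain ⟨j, hj⟩ : ∃ j, m j = 0 := by
      have : (0 : ℝ) ∈ Set.range m := by
        rw [Finset.range_orderEmbOfFin]
        exact Finset.mem_insert_self _ _
      exact this
    exact le_antisymm (hj ▸ m.monotone (Fin.zero_le j)) (hmem _ h1)
  · rw [hf, dirichletSum]
    have h2 : ∑ n, c (m n) * Complex.exp (-(m n : ℂ) * (s : ℂ)) =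
        ∑ x ∈ S, c x * Complex.exp (-(x : ℂ) * (s : ℂ)) := by
      rw [← Finset.image_orderEmbOfFin_univ S hN,
        Finset.sum_image fun i _ j _ h => m.injective h]
    rw [h2, ← Finset.sum_fiberwise_of_maps_to (s := Finset.univ) (t := S) (g := l)
      fun i _ => Finset.mem_insert_of_mem (Finset.mem_image_of_mem l (Finset.mem_univ i))]
    refine Finset.sum_congr rfl fun x _ => ?_
    rw [Finset.sum_mul]
    refine Finset.sum_congr rfl fun i hi => ?_
    rw [(Finset.mem_filter.1 hi).2]

theorem exists_sum_of_mem {f : halfPlane 0 →ᵇ ℂ} (hf : f ∈ generalDirichletPolynomials) :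
    ∃ (N : ℕ) (a : Fin (N + 1) → ℂ) (l : Fin (N + 1) → ℝ), (∀ n, 0 ≤ l n) ∧
      ∀ s, f s = ∑ n, a n * Complex.exp (-(l n : ℂ) * (s : ℂ)) := by
  obtain ⟨N, a, l, h0, hl, h⟩ := hf
  exact ⟨N, a, l, fun n => h0 ▸ hl.monotone (Fin.zero_le n), h⟩

/-- The general Dirichlet polynomials as a subspace. -/
def dirichletSubmodule : Submodule ℂ (halfPlane 0 →ᵇ ℂ) where
  carrier := generalDirichletPolynomials
  zero_mem' := mem_generalDirichletPolynomials (ι := Empty) (a := Empty.elim) (l := Empty.elim)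
    (fun i => i.elim) fun s => by simp
  add_mem' := by
    intro f g hf hg
    obtain ⟨N, a, l, hl, h⟩ := exists_sum_of_mem hf
    obtain ⟨M, b, m, hm, h'⟩ := exists_sum_of_mem hg
    refine mem_generalDirichletPolynomials (a := Sum.elim a b) (l := Sum.elim l m)
      (by rintro (i | i); exacts [hl i, hm i]) fun s => ?_
    simp [Fintype.sum_sum_type, h, h']
  smul_mem' := by
    intro c f hf
    obtain ⟨N, a, l, hl, h⟩ := exists_sum_of_mem hf
    refine mem_generalDirichletPolynomials (a := c • a) hl fun s => ?_
    simp [h, Finset.mul_sum, mul_assoc]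

/-- A function on a half-plane that is multiplied by scalars under vertical translations is an
exponential. -/
theorem exists_eq_exp_of_forall_add {F : ℂ → ℂ} (hF : DifferentiableOn ℂ F (halfPlane 0))
    {c : ℝ → ℂ} (h : ∀ τ : ℝ, ∀ s ∈ halfPlane 0, F (s + Complex.I * τ) = c τ * F s) :
    ∃ C m : ℂ, ∀ s ∈ halfPlane 0, F s = C * Complex.exp (-m * s) := by
  have hO := isOpen_halfPlane 0
  by_cases hz : ∀ s ∈ halfPlane 0, F s = 0
  · exact ⟨0, 0, fun s hs => by simp [hz s hs]⟩
  push Not at hz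
  obtain ⟨z, hz, hFz⟩ := hz
  have hd : ∀ s ∈ halfPlane 0, DifferentiableAt ℂ F s := fun s hs =>
    hF.differentiableAt (hO.mem_nhds hs)
  have hd' : DifferentiableOn ℂ (deriv F) (halfPlane 0) := hF.deriv hO
  have hshift : ∀ τ : ℝ, deriv F (z + Complex.I * τ) = c τ * deriv F z := by
    intro τ
    rw [← deriv_comp_add_const, ← deriv_const_mul _ (hd z hz)]
    refine Filter.EventuallyEq.deriv_eq ?_
    filter_upwards [hO.mem_nhds hz] with s hs using h τ s hs
  -- Both `F` and `F'` pick up the factor `c τ`, so `W` vanishes on the vertical line through `z`,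
  -- hence everywhere by the identity theorem. No regularity of `c` is needed.
  let W : ℂ → ℂ := fun s => deriv F s * F z - F s * deriv F z
  have hW : DifferentiableOn ℂ W (halfPlane 0) := (hd'.mul_const _).sub (hF.mul_const _)
  have hW0 : Set.EqOn W 0 (halfPlane 0) := by
    refine (hW.analyticOnNhd hO).eqOn_zero_of_preconnected_of_frequently_eq_zero
      (convex_halfPlane 0).isPreconnected hz ?_
    have ht : Filter.Tendsto (fun τ : ℝ => z + Complex.I * τ) (nhdsWithin 0 {0}ᶜ)
        (nhdsWithin z {z}ᶜ) := by
      refine tendsto_nhdsWithin_iff.2 ⟨?_, ?_⟩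
      · have : Continuous fun τ : ℝ => z + Complex.I * τ := by fun_prop
        simpa using (this.tendsto 0).mono_left nhdsWithin_le_nhds
      · filter_upwards [self_mem_nhdsWithin] with τ hτ
        simpa using hτ
    refine ht.frequently (Filter.Eventually.frequently (Filter.Eventually.of_forall fun τ => ?_))
    simp only [W, hshift, h τ z hz]
    ring
  let m : ℂ := -(deriv F z / F z)
  have hm : ∀ s ∈ halfPlane 0, deriv F s = -m * F s := by
    intro s hs
    have := hW0 hs
    simp only [W, Pi.zero_apply, sub_eq_zero] at this
    rw [neg_neg, div_mul_eq_mul_div, eq_div_iff hFz, this, mul_comm]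
  let E : ℂ → ℂ := fun s => F s * Complex.exp (m * s)
  have hE : ∀ s ∈ halfPlane 0, HasDerivAt E 0 s := by
    intro s hs
    have h1 := (hd s hs).hasDerivAt.mul (((hasDerivAt_id s).const_mul m).cexp)
    refine h1.congr_deriv ?_
    rw [hm s hs]
    simp only [id]
    ring
  have hconst : ∀ s ∈ halfPlane 0, E s = E z := fun s hs =>
    hO.is_const_of_deriv_eq_zero (convex_halfPlane 0).isPreconnected
      (fun s hs => (hE s hs).differentiableAt.differentiableWithinAt)
      (fun s hs => (hE s hs).deriv) hs hz
  refine ⟨E z, m, fun s hs => ?_⟩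
  rw [← hconst s hs, mul_assoc, ← Complex.exp_add]
  simp

/-- Boundedness of `C exp (-m s)` along a vertical line forces `m.im = 0`, and along the positive
axis `0 ≤ m.re`. -/
theorem HInfty_eigenvector_mem {f : halfPlane 0 →ᵇ ℂ} (hf : f ∈ HInfty) {c : ℝ → ℂ}
    (h : ∀ τ, boundedShift τ f = c τ • f) : f ∈ generalDirichletPolynomials := by
  obtain ⟨F, hF, hfF⟩ := hf
  obtain ⟨C, m, hCm⟩ := exists_eq_exp_of_forall_add hF (c := c) fun τ s hs => by
    have := DFunLike.congr_fun (h τ) ⟨s, hs⟩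
    rw [boundedShift_apply, hfF, BoundedContinuousFunction.smul_apply, hfF] at this
    exact this
  have hfC : ∀ s : halfPlane 0, f s = C * Complex.exp (-m * s) := fun s => by rw [hfF, hCm s s.2]
  rcases eq_or_ne C 0 with rfl | hC
  · have : f = 0 := by ext s; simp [hfC]
    exact this ▸ dirichletSubmodule.zero_mem
  have hK : ∀ s ∈ halfPlane 0, -(m * s).re ≤ Real.log (‖f‖ / ‖C‖) := by
    intro s hs
    have h1 := f.norm_coe_le_norm ⟨s, hs⟩
    rw [hfC, norm_mul, Complex.norm_exp, ← le_div_iff₀' (norm_pos_iff.2 hC)] at h1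
    simpa using (Real.le_log_iff_exp_le ((Real.exp_pos _).trans_le h1)).2 h1
  set K := Real.log (‖f‖ / ‖C‖)
  have hb : ∀ x y : ℝ, 0 < x → -(m.re * x - m.im * y) ≤ K := fun x y hx => by
    simpa using hK ⟨x, y⟩ hx
  have him : m.im = 0 := by
    by_contra hne
    have := hb 1 ((K + m.re + 1) / m.im) one_pos
    rw [mul_div_cancel₀ _ hne] at this
    linarith
  have hre : 0 ≤ m.re := by
    by_contra! hneg
    have h1 := hb ((|K| + 1) / -m.re) 0 (by have := neg_pos.2 hneg; positivity)
    have h2 : m.re * ((|K| + 1) / -m.re) = -(|K| + 1) := by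
      rw [div_neg, mul_neg, mul_div_cancel₀ _ hneg.ne]
    rw [h2] at h1
    linarith [le_abs_self K]
  refine mem_generalDirichletPolynomials (ι := Unit) (a := fun _ => C) (l := fun _ => m.re)
    (fun _ => hre) fun s => ?_
  have : (m.re : ℂ) = m := Complex.ext (by simp) (by simp [him])
  simp [this, hfC]

/-! ### Almost periodicity up to the boundary -/

/-- A qualitative form of the three lines theorem on the right half-plane: a bounded analytic
function that is small on a smaller half-plane is small away from the boundary. -/
theorem exists_three_lines_bound {M κ η ε : ℝ} (hM : 0 < M) (hη : 0 < η) (hηκ : η < κ)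
    (hε : 0 < ε) :
    ∃ δ : ℝ, 0 < δ ∧ ∀ h : ℂ → ℂ, DifferentiableOn ℂ h (halfPlane 0) →
      (∀ s ∈ halfPlane 0, ‖h s‖ ≤ M) → (∀ s ∈ halfPlane κ, ‖h s‖ ≤ δ) →
      ∀ s : ℂ, η ≤ s.re → ‖h s‖ ≤ ε := by
  -- The edges `η / 2` and `2 * κ` lie strictly inside the half-planes where the two bounds hold.
  set l := η / 2 with hl
  set u := 2 * κ with hu
  have hul : 0 < u - l := by linarith
  set θ := (η - l) / (u - l) with hθ
  have hθ0 : 0 < θ := div_pos (by linarith) hul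
  -- With right-edge bound `M * r ^ (1 / θ)`, interpolation at `t ≥ θ` gives `M * r ^ (t / θ) ≤ M *
  -- r ≤ ε`, using `r ≤ 1`.
  set r := min (ε / M) 1 with hr
  have hr0 : 0 < r := lt_min (div_pos hε hM) one_pos
  have hδ0 : 0 < M * r ^ (1 / θ) := by positivity
  refine ⟨min (M * r ^ (1 / θ)) ε, lt_min hδ0 hε, fun h hd hb hs s hsη => ?_⟩
  rcases lt_or_ge κ s.re with hκ | hκ
  · exact (hs s hκ).trans (min_le_right _ _)
  have hsub : Complex.HadamardThreeLines.verticalClosedStrip l u ⊆ halfPlane 0 := fun z hz => by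
    have : l ≤ z.re := hz.1
    change 0 < z.re
    linarith
  have hcl : closure (Complex.HadamardThreeLines.verticalStrip l u) ⊆
      Complex.HadamardThreeLines.verticalClosedStrip l u :=
    closure_minimal (Set.preimage_mono Set.Ioo_subset_Icc_self)
      (isClosed_Icc.preimage Complex.continuous_re)
  have h1 := Complex.HadamardThreeLines.norm_le_interp_of_mem_verticalClosedStrip' (f := h) (z := s)
    (a := M) (b := M * r ^ (1 / θ)) (sub_pos.1 hul) ⟨by linarith, by linarith⟩
    (hd.mono (hcl.trans hsub)).diffContOnCl
    ⟨M, by rintro _ ⟨z, hz, rfl⟩; exact hb z (hsub hz)⟩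
    (fun z hz => hb z (hsub ⟨hz.ge, hz.le.trans (sub_pos.1 hul).le⟩))
    (fun z hz => (hs z (by
      have : z.re = u := hz
      change κ < z.re
      linarith)).trans (min_le_left _ _))
  refine h1.trans ?_
  set t := (s.re - l) / (u - l)
  have ht : θ ≤ t := by
    simp only [hθ, t]
    gcongr
  rw [Real.mul_rpow hM.le (by positivity), ← mul_assoc, ← Real.rpow_add hM, ← Real.rpow_mul hr0.le,
    sub_add_cancel, Real.rpow_one]
  calc M * r ^ (1 / θ * t) ≤ M * r ^ (1 : ℝ) := by
        gcongr M * ?_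
        refine Real.rpow_le_rpow_of_exponent_ge hr0 (min_le_right _ _) ?_
        rw [one_div_mul_eq_div, one_le_div hθ0]
        exact ht
    _ ≤ M * (ε / M) := by
        rw [Real.rpow_one]
        gcongr
        exact min_le_left _ _
    _ = ε := mul_div_cancel₀ _ hM.ne'

theorem RelativelyDense.mono {A B : Set ℝ} (hA : RelativelyDense A) (h : A ⊆ B) :
    RelativelyDense B := by
  obtain ⟨d, hd, h'⟩ := hA
  exact ⟨d, hd, fun x => (h' x).mono (Set.inter_subset_inter_left _ h)⟩

/-- Shifting right by `η` costs `ε / 3` twice, by uniform continuity; on `η ≤ Re s` the three lines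
bound makes a `δ`-translation number on the smaller half-plane an `ε / 3` one. -/
theorem relativelyDense_of_mem_AlgebraAP {f : halfPlane 0 →ᵇ ℂ} (hf : f ∈ AlgebraAP) {ε : ℝ}
    (hε : 0 < ε) : RelativelyDense {τ | ‖boundedShift τ f - f‖ ≤ ε} := by
  obtain ⟨⟨⟨F, hF, hfF⟩, κ, hκ, -, -, hap⟩, huc⟩ := hf
  obtain ⟨η₀, hη₀, hη₀'⟩ := Metric.uniformContinuous_iff.1 huc (ε / 3) (by positivity)
  set η := min (η₀ / 2) (κ / 2)
  have hη : 0 < η := by positivity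
  have hη1 : η < η₀ := (min_le_left _ _).trans_lt (half_lt_self hη₀)
  have hη2 : η < κ := (min_le_right _ _).trans_lt (half_lt_self hκ)
  obtain ⟨δ, hδ, hδ'⟩ := exists_three_lines_bound (M := 2 * ‖f‖ + 1) (by positivity) hη hη2
    (ε := ε / 3) (by positivity)
  refine (hap δ hδ).mono fun τ hτ => ?_
  have hmove : ∀ s : halfPlane 0, ∀ h : (s : ℂ) + η ∈ halfPlane 0,
      ‖f ⟨s + η, h⟩ - f s‖ ≤ ε / 3 := fun s h => by
    rw [← dist_eq_norm]
    refine (hη₀' ?_).le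
    rw [Subtype.dist_eq, dist_eq_norm]
    simpa [abs_of_pos hη] using hη1
  have hmem : ∀ s : halfPlane 0, (s : ℂ) + η ∈ halfPlane 0 := fun s => by
    have : 0 < (s : ℂ).re := s.2
    change 0 < ((s : ℂ) + η).re
    simp only [Complex.add_re, Complex.ofReal_re]
    linarith
  have hFf : ∀ z (hz : z ∈ halfPlane 0), F z = f ⟨z, hz⟩ := fun z hz => (hfF ⟨z, hz⟩).symm
  have h3 := hδ' (fun z => F (z + Complex.I * τ) - F z)
    ((hF.comp (by fun_prop) fun z hz => add_mem_halfPlane hz).sub hF)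
    (fun z hz => by
      rw [hFf _ (add_mem_halfPlane hz), hFf _ hz]
      refine (norm_sub_le _ _).trans ?_
      linarith [f.norm_coe_le_norm ⟨z, hz⟩, f.norm_coe_le_norm ⟨_, add_mem_halfPlane (τ := τ) hz⟩])
    (fun z hz => by
      have hz0 : z ∈ halfPlane 0 := halfPlane_subset hκ.le hz
      rw [hFf _ (add_mem_halfPlane hz0), hFf _ hz0]
      exact hτ ⟨z, hz⟩)
  refine (BoundedContinuousFunction.norm_le hε.le).2 fun s => ?_
  rw [BoundedContinuousFunction.sub_apply, boundedShift_apply]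
  have e1 := hmove s (hmem s)
  have e2 := hmove (verticalShift τ s) (hmem _)
  have e3 := h3 (s + η) (by
    have : 0 < (s : ℂ).re := s.2
    simp only [Complex.add_re, Complex.ofReal_re]
    linarith)
  have e4 : F ((s : ℂ) + η + Complex.I * τ) = f ⟨verticalShift τ s + η, hmem _⟩ := by
    rw [hfF]
    congr 1
    simp only [verticalShift]
    ring
  simp only [e4, hFf _ (hmem s)] at e3
  have e5 : f (verticalShift τ s) - f s =
      -(f ⟨verticalShift τ s + η, hmem _⟩ - f (verticalShift τ s)) +
      (f ⟨verticalShift τ s + η, hmem _⟩ - f ⟨s + η, hmem s⟩) + (f ⟨s + η, hmem s⟩ - f s) := by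
    ring
  rw [e5]
  refine (norm_add₃_le).trans ?_
  rw [norm_neg]
  linarith

theorem AlgebraAP_subset : AlgebraAP ⊆ closure generalDirichletPolynomials := by
  intro f hf
  have hfH : f ∈ HInfty := hf.1.1
  -- Norm continuity of the orbit uses uniform continuity up to the boundary.
  have hc : Continuous fun τ => HInftyShift τ ⟨f, hfH⟩ := by
    have : Continuous fun τ => boundedShift τ f := by
      refine Metric.continuous_iff.2 fun a ε hε => ?_
      obtain ⟨δ, hδ, h⟩ := Metric.uniformContinuous_iff.1 hf.2 (ε / 2) (half_pos hε)
      refine ⟨δ, hδ, fun b hb => ?_⟩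
      refine ((BoundedContinuousFunction.dist_le (half_pos hε).le).2 fun s => ?_).trans_lt
        (half_lt_self hε)
      refine (h ?_).le
      rw [Subtype.dist_eq, dist_eq_norm]
      change ‖((s : ℂ) + Complex.I * b) - (s + Complex.I * a)‖ < δ
      rw [add_sub_add_left_eq_sub, ← mul_sub, ← Complex.ofReal_sub, norm_mul, Complex.norm_I,
        one_mul, Complex.norm_real, ← dist_eq_norm]
      exact hb
    exact this.subtype_mk _
  have key := mem_closure_span_eigenvectors (U := HInftyShift)
    (fun v => Subtype.ext (boundedShift_zero v))
    (fun a b v => Subtype.ext (boundedShift_add a b v)) hc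
    (fun ε hε => relativelyDense_of_mem_AlgebraAP hf hε)
  have hsub : Submodule.span ℂ {w : HInfty | ∃ c : ℝ → ℂ, ∀ τ, HInftyShift τ w = c τ • w} ≤
      dirichletSubmodule.comap HInfty.subtype := by
    refine Submodule.span_le.2 ?_
    rintro w ⟨c, hw⟩
    exact HInfty_eigenvector_mem w.2 fun τ => congrArg Subtype.val (hw τ)
  exact map_mem_closure continuous_subtype_val key hsub

/-! ### Dirichlet polynomials and their uniform limits are almost periodic -/

/-- The curve `v` runs in a torus, so finitely many of its points `v (g y)` form an `ε`-net.
Subtracting the parameter of a nearby net point leaves a common almost-period. -/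
theorem relativelyDense_exp {N : ℕ} (l : Fin N → ℝ) {ε : ℝ} (hε : 0 < ε) :
    RelativelyDense {τ : ℝ | ∀ n, ‖Complex.exp (-(l n : ℂ) * (Complex.I * τ)) - 1‖ < ε} := by
  let v : ℝ → Fin N → ℂ := fun τ n => Complex.exp (-(l n : ℂ) * (Complex.I * τ))
  have hnorm : ∀ τ n, ‖v τ n‖ = 1 := fun τ n => by simp [v, Complex.norm_exp]
  have hb : Bornology.IsBounded (Set.range v) := by
    refine isBounded_iff_forall_norm_le.2 ⟨1, ?_⟩
    rintro _ ⟨τ, rfl⟩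
    exact (pi_norm_le_iff_of_nonneg zero_le_one).2 fun n => (hnorm τ n).le
  obtain ⟨t, htv, ht, hcov⟩ := Metric.finite_approx_of_totallyBounded
    (hb.isCompact_closure.totallyBounded.subset subset_closure) ε hε
  choose g hg using fun y : t => htv y.2
  have := ht.to_subtype
  obtain ⟨M, hM⟩ := (Set.finite_range fun y => |g y|).bddAbove
  -- Starting from `x + |M|` and subtracting `g y`, with `|g y| ≤ |M|`, lands in `[x, x + 2 * |M|]`;
  -- the `1` keeps the length positive.
  refine ⟨2 * |M| + 1, by positivity, fun x => ?_⟩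
  obtain ⟨y, hy, hxy⟩ := Set.mem_iUnion₂.1 (hcov ⟨x + |M|, rfl⟩)
  have h1 : |g ⟨y, hy⟩| ≤ |M| := (hM ⟨⟨y, hy⟩, rfl⟩).trans (le_abs_self M)
  have h2 := abs_le.1 h1
  refine ⟨x + |M| - g ⟨y, hy⟩, fun n => ?_, by linarith, by linarith⟩
  rw [← show v (g ⟨y, hy⟩) = y from hg ⟨y, hy⟩, Metric.mem_ball, dist_eq_norm] at hxy
  have h3 := (norm_le_pi_norm _ n).trans_lt hxy
  have h4 : v (x + |M|) n - v (g ⟨y, hy⟩) n =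
      (Complex.exp (-(l n : ℂ) * (Complex.I * ((x + |M| - g ⟨y, hy⟩ : ℝ) : ℂ))) - 1) *
        v (g ⟨y, hy⟩) n := by
    rw [sub_mul, one_mul]
    simp only [v, ← Complex.exp_add]
    congr 2
    push_cast
    ring
  rwa [Pi.sub_apply, h4, norm_mul, hnorm, mul_one] at h3

theorem relativelyDense_of_mem_generalDirichletPolynomials {f : halfPlane 0 →ᵇ ℂ}
    (hf : f ∈ generalDirichletPolynomials) {ε : ℝ} (hε : 0 < ε) :
    RelativelyDense (translationNumbers f ε) := by
  obtain ⟨N, a, l, hl, h⟩ := exists_sum_of_mem hf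
  set A := ∑ n, ‖a n‖
  have hA : 0 ≤ A := Finset.sum_nonneg fun _ _ => norm_nonneg _
  refine (relativelyDense_exp l (ε := ε / (A + 1)) (by positivity)).mono fun τ hτ s => ?_
  have hs : 0 < (s : ℂ).re := s.2
  rw [h, h, ← Finset.sum_sub_distrib]
  calc _ ≤ ∑ n, ‖a n‖ * (ε / (A + 1)) := by
        refine norm_sum_le_of_le _ fun n _ => ?_
        have h1 : a n * Complex.exp (-(l n : ℂ) * (verticalShift τ s : ℂ)) -
            a n * Complex.exp (-(l n : ℂ) * (s : ℂ)) =
            a n * (Complex.exp (-(l n : ℂ) * (s : ℂ)) *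
              (Complex.exp (-(l n : ℂ) * (Complex.I * τ)) - 1)) := by
          rw [mul_sub (Complex.exp _), ← Complex.exp_add, verticalShift, mul_add]
          ring
        rw [h1, norm_mul, norm_mul]
        gcongr
        refine (mul_le_of_le_one_left (norm_nonneg _) ?_).trans (hτ n).le
        rw [Complex.norm_exp, Real.exp_le_one_iff]
        simpa using mul_nonneg (hl n) hs.le
    _ = A * ε / (A + 1) := by rw [← Finset.sum_mul, mul_div_assoc]
    _ ≤ ε := by
        rw [div_le_iff₀ (by positivity)]
        nlinarith

theorem uniformContinuous_of_mem_generalDirichletPolynomials {f : halfPlane 0 →ᵇ ℂ}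
    (hf : f ∈ generalDirichletPolynomials) : UniformContinuous f := by
  obtain ⟨N, a, l, hl, h⟩ := exists_sum_of_mem hf
  have hterm : ∀ n, ∀ s t : halfPlane 0, ‖Complex.exp (-(l n : ℂ) * (s : ℂ)) -
      Complex.exp (-(l n : ℂ) * (t : ℂ))‖ ≤ l n * ‖(s : ℂ) - t‖ := by
    intro n s t
    have hd : ∀ z : ℂ, HasDerivAt (fun z => Complex.exp (-(l n : ℂ) * z))
        (Complex.exp (-(l n : ℂ) * z) * -(l n : ℂ)) z := fun z => by
      simpa using ((hasDerivAt_id z).const_mul (-(l n : ℂ))).cexp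
    refine (convex_halfPlane 0).norm_image_sub_le_of_norm_hasDerivWithin_le
      (fun z _ => (hd z).hasDerivWithinAt) (fun z hz => ?_) t.2 s.2
    have hz' : 0 < z.re := hz
    rw [norm_mul, norm_neg, Complex.norm_real, Real.norm_of_nonneg (hl n)]
    refine mul_le_of_le_one_left (hl n) ?_
    rw [Complex.norm_exp, Real.exp_le_one_iff]
    simpa using mul_nonneg (hl n) hz'.le
  have hL : LipschitzWith (∑ n, ‖a n‖ * l n).toNNReal f := by
    refine LipschitzWith.of_dist_le_mul fun s t => ?_
    rw [Real.coe_toNNReal _ (Finset.sum_nonneg fun n _ => mul_nonneg (norm_nonneg _) (hl n)),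
      Subtype.dist_eq, dist_eq_norm, dist_eq_norm, h, h, ← Finset.sum_sub_distrib, Finset.sum_mul]
    refine norm_sum_le_of_le _ fun n _ => ?_
    rw [← mul_sub, norm_mul, mul_assoc]
    gcongr
    exact hterm n s t
  exact hL.uniformContinuous

theorem generalDirichletPolynomials_subset_HInfty :
    generalDirichletPolynomials ⊆ (HInfty : Set (halfPlane 0 →ᵇ ℂ)) := by
  rintro f ⟨N, a, l, -, -, h⟩
  refine ⟨fun z => ∑ n, a n * Complex.exp (-(l n : ℂ) * z), ?_, h⟩
  exact Differentiable.differentiableOn (by fun_prop)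

theorem closure_subset_AlgebraAP : closure generalDirichletPolynomials ⊆ AlgebraAP := by
  intro f hf
  have happrox : ∀ ε : ℝ, 0 < ε → ∃ g ∈ generalDirichletPolynomials, ∀ s, ‖f s - g s‖ ≤ ε := by
    intro ε hε
    obtain ⟨g, hg, hfg⟩ := Metric.mem_closure_iff.1 hf ε hε
    refine ⟨g, hg, fun s => ?_⟩
    rw [dist_eq_norm] at hfg
    exact ((f - g).norm_coe_le_norm s).trans hfg.le
  have huc : UniformContinuous f := by
    obtain ⟨u, hu, hlim⟩ := mem_closure_iff_seq_limit.1 hf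
    exact (BoundedContinuousFunction.tendsto_iff_tendstoUniformly.1 hlim).uniformContinuous
      (Filter.Frequently.of_forall fun n =>
        uniformContinuous_of_mem_generalDirichletPolynomials (hu n))
  -- The choice `κ = 1` is arbitrary: the approximation holds on the whole half-plane.
  refine ⟨⟨closure_minimal generalDirichletPolynomials_subset_HInfty isClosed_HInfty hf, 1, one_pos,
    ⟨‖f‖, fun s => f.norm_coe_le_norm _⟩, ?_, fun ε hε => ?_⟩, huc⟩
  · exact huc.comp (uniformContinuous_subtype_val.subtype_mk _)
  · obtain ⟨g, hg, hfg⟩ := happrox (ε / 3) (by positivity)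
    refine (relativelyDense_of_mem_generalDirichletPolynomials hg (ε := ε / 3)
      (by positivity)).mono fun τ hτ s => ?_
    set t := Set.inclusion (halfPlane_subset zero_le_one) s
    change ‖f (verticalShift τ t) - f t‖ ≤ ε
    have e1 := hfg (verticalShift τ t)
    have e2 := hfg t
    have e3 := hτ t
    have e4 : f (verticalShift τ t) - f t = (f (verticalShift τ t) - g (verticalShift τ t)) +
        (g (verticalShift τ t) - g t) + -(f t - g t) := by ring
    rw [e4]
    refine norm_add₃_le.trans ?_
    rw [norm_neg]
    linarith

theorem mainTheorem3 : AlgebraAP = closure generalDirichletPolynomials :=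
  AlgebraAP_subset.antisymm closure_subset_AlgebraAP
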